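/- Graphs are finite multigraphs (parallel edges and loops are allowed). For a graph $G$ and a set $T\subseteq V(G)$, a \emph{join} of $(G,T)$ is a set $F\subseteq E(G)$ such that, for every vertex $v$, the number of edges of $F$ joining $v$ to a vertex other than $v$ is odd if $v\in T$ and even if $v\notin T$. The pair $(G,T)$ is a \emph{graft} if every connected component of $G$ contains an even number of vertices of $T$; equivalently, if it has a join. For a graft $(G,T)$, let $\nu(G,T)$ be the minimum number of edges of a join. A graft $(G,T)$ is \emph{factor-critical with root} $r\in V(G)$ if, for every $v\in V(G)\setminus\{r\}$, the pair $(G,T\,\Delta\,\{r,v\})$ is a graft and $\nu(G,T)=\nu(G,T\,\Delta\,\{r,v\})$, where $\Delta$ denotes symmetric difference. A graph $P$ with at least one edge is a \emph{round ear} relative to a graph $G$ if $P$ is a path that shares exactly its two ends with $V(G)$, or a circuit that shares exactly one vertex with $V(G)$ (a loop and a pair of parallel edges count as circuits); the vertices in $V(P)\cap V(G)$ are its \emph{bonds}. The \emph{sum} of grafts $(G_1,T_1)$ and $(G_2,T_2)$, where $G_1$ and $G_2$ are subgraphs of a common graph, is $(G_1,T_1)\oplus(G_2,T_2)=(G_1+G_2,\,T_1\,\Delta\,T_2)$,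 where $G_1+G_2$ is the union of $G_1$ and $G_2$. For a vertex $r$, let $\mathcal{F}(r)$ be the smallest family of grafts such that (i) $((\{r\},\emptyset),\emptyset)\in\mathcal{F}(r)$; and (ii) if $(G,T)\in\mathcal{F}(r)$ and $(P,T')$ is a graft such that $P$ is a round ear relative to $G$, no bond of $P$ lies in $T'$, and all other vertices of $P$ lie in $T'$, then $(G,T)\oplus(P,T')\in\mathcal{F}(r)$. \textbf{Theorem.} For every graph $G$, every set $T\subseteq V(G)$ and every vertex $r$, the pair $(G,T)$ is a factor-critical graft with root $r$ if and only if it is a member of $\mathcal{F}(r)$. -/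

import Mathlib

open scoped Graph symmDiff

namespace Graft

variable {α β : Type*}

/-- `F` is a join of `(G, T)`: a set of edges such that the number of edges of `F` in the cut
`δ(v)` (loops are not in a cut) is odd for `v ∈ T` and even for the other vertices `v`. -/
def IsJoin (G : Graph α β) (T : Set α) (F : Set β) : Prop :=
  F ⊆ E(G) ∧ ∀ v ∈ V(G), (v ∈ T → Odd ({e | G.IsNonloopAt e v} ∩ F).ncard) ∧
    (v ∉ T → Even ({e | G.IsNonloopAt e v} ∩ F).ncard)

/-- The vertex set of the connected component of `G` that contains `x`. -/
def component (G : Graph α β) (x : α) : Set α :=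
  {y | Relation.ReflTransGen G.Adj x y}

/-- `(G, T)` is a graft: `G` is a finite multigraph, `T ⊆ V(G)`, and every connected component
of `G` contains an even number of vertices of `T`. -/
structure IsGraft (G : Graph α β) (T : Set α) : Prop where
  finite_vertexSet : V(G).Finite
  finite_edgeSet : E(G).Finite
  subset : T ⊆ V(G)
  even_component : ∀ x ∈ V(G), Even (component G x ∩ T).ncard

/-- The number of edges in a minimum join of `(G, T)` (only used for grafts, which always have
a join). -/
noncomputable def nu (G : Graph α β) (T : Set α) : ℕ :=
  sInf {n | ∃ F, IsJoin G T F ∧ F.ncard = n}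

/-- `(G, T)` is a factor-critical graft with root `r`: it is a graft, `r` is a vertex, and for
every other vertex `v` also `(G, T ∆ {r, v})` is a graft, with the same minimum size of a join. -/
structure IsFactorCritical (G : Graph α β) (T : Set α) (r : α) : Prop where
  isGraft : IsGraft G T
  root_mem : r ∈ V(G)
  isGraft_symmDiff : ∀ v ∈ V(G), v ≠ r → IsGraft G (T ∆ {r, v})
  nu_eq : ∀ v ∈ V(G), v ≠ r → nu G T = nu G (T ∆ {r, v})

/-- The graph `P` is a path with ends `s` and `t`: its vertices can be listed without repetition
as `x 0 = s, …, x n = t` and its edges as `e 0, …, e (n - 1)`, where `e i` links `x i` and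
`x (i + 1)`. -/
def IsPathBetween (P : Graph α β) (s t : α) : Prop :=
  ∃ (n : ℕ) (x : ℕ → α) (e : ℕ → β), x 0 = s ∧ x n = t ∧
    Set.InjOn x (Set.Iic n) ∧ V(P) = x '' Set.Iic n ∧ E(P) = e '' Set.Iio n ∧
    ∀ i < n, P.IsLink (e i) (x i) (x (i + 1))

/-- The graph `P` is a circuit: for some `n ≥ 1`, its vertices can be listed without repetition
as `x 0, …, x (n - 1)` and its edges without repetition as `e 0, …, e (n - 1)`, where `e i` links
`x i` and `x (i + 1)`, with `x n = x 0`. (For `n = 1` this is a loop, for `n = 2` a pair of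
parallel edges.) -/
def IsCircuit (P : Graph α β) : Prop :=
  ∃ (n : ℕ) (x : ℕ → α) (e : ℕ → β), 0 < n ∧ x n = x 0 ∧
    Set.InjOn x (Set.Iio n) ∧ Set.InjOn e (Set.Iio n) ∧
    V(P) = x '' Set.Iio n ∧ E(P) = e '' Set.Iio n ∧
    ∀ i < n, P.IsLink (e i) (x i) (x (i + 1))

/-- `P` is a round ear relative to `X`: it has an edge, and it is a path that shares exactly its
two ends with `X`, or a circuit that shares exactly one vertex with `X`. -/
def IsRoundEar (P : Graph α β) (X : Set α) : Prop :=
  E(P).Nonempty ∧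
    ((∃ s t, IsPathBetween P s t ∧ V(P) ∩ X = {s, t}) ∨
      (IsCircuit P ∧ ∃ s, V(P) ∩ X = {s}))

/-- The sum (union) `G + H` of two graphs that give the same ends to their common edges, i.e.
of two subgraphs of a common graph. -/
def graphSum (G H : Graph α β) (h : G.Compatible H) : Graph α β where
  vertexSet := V(G) ∪ V(H)
  edgeSet := E(G) ∪ E(H)
  IsLink e x y := G.IsLink e x y ∨ H.IsLink e x y
  isLink_symm := by
    intro e _
    exact ⟨fun x y hxy => hxy.imp (fun h => h.symm) (fun h => h.symm)⟩
  eq_or_eq_of_isLink_of_isLink := by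
    intro e x y v w h₁ h₂
    rcases h₁ with h₁ | h₁ <;> rcases h₂ with h₂ | h₂
    · exact h₁.left_eq_or_eq h₂
    · exact (h₁.of_compatible h h₂.edge_mem).left_eq_or_eq h₂
    · exact h₁.left_eq_or_eq (h₂.of_compatible h h₁.edge_mem)
    · exact h₁.left_eq_or_eq h₂
  edge_mem_iff_exists_isLink := by
    intro e
    constructor
    · rintro (he | he)
      · obtain ⟨x, y, hxy⟩ := G.exists_isLink_of_mem_edgeSet he
        exact ⟨x, y, Or.inl hxy⟩
      · obtain ⟨x, y, hxy⟩ := H.exists_isLink_of_mem_edgeSet he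
        exact ⟨x, y, Or.inr hxy⟩
    · rintro ⟨x, y, hxy | hxy⟩
      · exact Or.inl hxy.edge_mem
      · exact Or.inr hxy.edge_mem
  left_mem_of_isLink := by
    rintro e x y (hxy | hxy)
    · exact Or.inl hxy.left_mem
    · exact Or.inr hxy.left_mem

/-- The family of grafts obtained from `(({r}, ∅), ∅)` by repeatedly adding round ear grafts
`(P, T')` relative to the current graft `(G, T)` whose bonds, the vertices in `V(P) ∩ V(G)`,
lie outside `T'` and whose other vertices lie in `T'`. The sum of grafts is
`(G, T) ⊕ (P, T') = (G + P, T ∆ T')`. -/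
inductive EarFamily (r : α) : Graph α β → Set α → Prop
  | single : EarFamily r (Graph.noEdge {r} β) ∅
  | addEar (G : Graph α β) (T : Set α) (P : Graph α β) (T' : Set α)
      (hG : EarFamily r G T)
      (hP : IsGraft P T')
      (hc : G.Compatible P)
      (hear : IsRoundEar P V(G))
      (hinner : V(P) \ (V(P) ∩ V(G)) ⊆ T')
      (hbonds : (V(P) ∩ V(G)) ∩ T' = ∅) :
      EarFamily r (graphSum G P hc) (T ∆ T')

end Graft

open scoped Graph symmDiff

namespace Graft

/-! ### Odd-degree vertices of edge sets, parity, and existence of joins -/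

section OddSet

variable {α β : Type*}
-- Both sides describe graphs that are factor-critical in the matching sense: `T = V(G) \ {r}`, and
-- for every vertex `v` the set `V(G) \ {v}` has a join with only `(|V(G)| - 1) / 2` edges. The
-- theorem is then an odd ear decomposition in the style of Lovász. Joins are handled through
-- `oddSet`, which turns symmetric differences of edge sets into symmetric differences of vertex
-- sets.
--
-- From ears to factor-criticality: `HasNearPerfectJoins` is preserved under adding an ear
-- (`HasNearPerfectJoins.graphSum`). The graft condition makes the ear's length odd, `2 * m + 1`, so
-- there are `2 * m` new vertices, and `m` alternate edges of the ear extend an old join so as to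
-- miss any prescribed vertex. Since `k` edges have at most `2 * k` odd vertices, these joins are
-- minimum and all have the same size.
--
-- From factor-criticality to ears: a minimum join for `T ∆ ({r} ∆ {v})` has no non-loop edge at
-- `v`, as deleting one would give too small a join for another vertex; this forces `T = V(G) \ {r}`
-- (`IsFactorCritical.eq_sdiff`). An exchange argument along an even subset of the symmetric
-- difference of two minimum joins shows that a minimum join of `T` has at most one non-loop edge at
-- each vertex (`IsFactorCritical.eq_of_isNonloopAt`), so it yields a matching `m` missing only `r`.
-- Changing the root gives a matching `p` missing only `w`, for any `w`. If a subgraph closed under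
-- `m` has an edge leaving it to `w`, alternating `m` and `p` from `w` leads back to it along an odd
-- ear (`exists_isEarWalk`), and the enlarged subgraph is again closed under `m`. Iterating exhausts
-- the vertices; each remaining edge is an ear by itself.
lemma ncard_symmDiff_add {γ : Type*} {A B : Set γ} (hA : A.Finite) (hB : B.Finite) :
    (A ∆ B).ncard + 2 * (A ∩ B).ncard = A.ncard + B.ncard := by
  have h1 := Set.ncard_union_eq (s := A \ B) (t := B \ A)
    (Set.disjoint_left.2 fun x hx hx' => hx.2 hx'.1) hA.sdiff hB.sdiff
  have h2 := Set.ncard_inter_add_ncard_sdiff_eq_ncard A B hA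
  have h3 := Set.ncard_inter_add_ncard_sdiff_eq_ncard B A hB
  rw [Set.inter_comm B A] at h3
  rw [Set.symmDiff_def, h1]
  omega

lemma even_ncard_symmDiff {γ : Type*} {A B : Set γ} (hA : A.Finite) (hB : B.Finite) :
    Even (A ∆ B).ncard ↔ (Even A.ncard ↔ Even B.ncard) := by
  have h := ncard_symmDiff_add hA hB
  rw [← Nat.even_add, ← h]
  simp [Nat.even_add]

lemma insert_eq_symmDiff {γ : Type*} {A : Set γ} {a : γ} (ha : a ∉ A) :
    insert a A = A ∆ {a} := by
  ext x
  simp only [Set.mem_insert_iff, Set.mem_symmDiff, Set.mem_singleton_iff]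
  by_cases hx : x = a
  · subst hx; simp [ha]
  · simp [hx]

lemma pair_eq_symmDiff {γ : Type*} {a b : γ} (h : a ≠ b) : ({a, b} : Set γ) = {a} ∆ {b} := by
  rw [Set.pair_comm, insert_eq_symmDiff (by simpa using h.symm)]

lemma ncard_singleton_symmDiff_le {γ : Type*} (a b : γ) : (({a} : Set γ) ∆ {b}).ncard ≤ 2 := by
  have := ncard_symmDiff_add (Set.finite_singleton a) (Set.finite_singleton b)
  simp only [Set.ncard_singleton] at this
  omega

/-- The set of vertices incident with an odd number of non-loop edges of `K`. -/
def oddSet (G : Graph α β) (K : Set β) : Set α :=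
  {v | Odd ({e | G.IsNonloopAt e v} ∩ K).ncard}

variable {G H : Graph α β} {T : Set α} {K L F : Set β} {e : β} {x y u v r : α}

lemma oddSet_subset : oddSet G K ⊆ V(G) := by
  intro v hv
  have : ({e | G.IsNonloopAt e v} ∩ K).Nonempty := by
    rw [Set.nonempty_iff_ne_empty]
    intro h
    simp [oddSet, h] at hv
  obtain ⟨e, he, -⟩ := this
  exact he.vertex_mem

lemma oddSet_empty : oddSet G ∅ = ∅ := by
  simp [oddSet]

lemma oddSet_symmDiff (hK : K.Finite) (hL : L.Finite) :
    oddSet G (K ∆ L) = oddSet G K ∆ oddSet G L := by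
  ext v
  have h := even_ncard_symmDiff (hK.inter_of_right {e | G.IsNonloopAt e v})
    (hL.inter_of_right {e | G.IsNonloopAt e v})
  rw [← Set.inter_symmDiff_distrib_left] at h
  simp only [oddSet, Set.mem_symmDiff, Set.mem_ofPred_eq, ← Nat.not_even_iff_odd, h]
  tauto

lemma oddSet_singleton (h : G.IsLink e x y) : oddSet G {e} = {x} ∆ {y} := by
  ext v
  by_cases hv : G.IsNonloopAt e v
  · have : ({e | G.IsNonloopAt e v} ∩ {e} : Set β) = {e} := by
      ext f
      simp only [Set.mem_inter_iff, Set.mem_ofPred_eq, Set.mem_singleton_iff]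
      exact ⟨fun h => h.2, fun h => ⟨h ▸ hv, h⟩⟩
    simp only [oddSet, Set.mem_ofPred_eq, this, Set.ncard_singleton, odd_one, true_iff]
    obtain ⟨w, hw, hl⟩ := hv
    rcases hl.eq_and_eq_or_eq_and_eq h with ⟨rfl, rfl⟩ | ⟨rfl, rfl⟩
    · exact Or.inl ⟨rfl, hw.symm⟩
    · exact Or.inr ⟨rfl, hw.symm⟩
  · have : ({e | G.IsNonloopAt e v} ∩ {e} : Set β) = ∅ := by
      ext f
      simp only [Set.mem_inter_iff, Set.mem_ofPred_eq, Set.mem_singleton_iff,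
        Set.mem_empty_iff_false, iff_false, not_and]
      rintro hf rfl
      exact hv hf
    simp only [oddSet, Set.mem_ofPred_eq, this, Set.ncard_empty, Nat.not_odd_zero, false_iff]
    rintro (⟨h1, h2⟩ | ⟨h1, h2⟩)
    · rw [Set.mem_singleton_iff] at h1 h2
      subst h1
      exact hv ⟨y, fun h => h2 h.symm, h⟩
    · rw [Set.mem_singleton_iff] at h1 h2
      subst h1
      exact hv ⟨x, fun h => h2 h.symm, h.symm⟩

lemma oddSet_of_le (h : H ≤ G) (hK : K ⊆ E(H)) : oddSet G K = oddSet H K := by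
  ext v
  have : ({e | G.IsNonloopAt e v} ∩ K : Set β) = {e | H.IsNonloopAt e v} ∩ K := by
    ext e
    simp only [Set.mem_inter_iff, Set.mem_ofPred_eq]
    exact and_congr_left fun he => (h.isNonloopAt_congr (hK he)).symm
  simp [oddSet, this]

lemma isJoin_iff (hT : T ⊆ V(G)) : IsJoin G T F ↔ F ⊆ E(G) ∧ oddSet G F = T := by
  refine and_congr_right fun _ => ⟨fun h => ?_, ?_⟩
  · ext v
    refine ⟨fun hv => ?_, fun hv => (h v (hT hv)).1 hv⟩
    by_contra hvT
    exact Nat.not_even_iff_odd.2 hv ((h v (oddSet_subset hv)).2 hvT)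
  · rintro rfl v -
    exact ⟨id, Nat.not_odd_iff_even.1⟩

/-- Each edge changes the parity of at most two vertices. This is the lower bound on the size of a
join. -/
lemma finite_oddSet_and_ncard_le (hK : K ⊆ E(G)) (hfin : K.Finite) :
    (oddSet G K).Finite ∧ (oddSet G K).ncard ≤ 2 * K.ncard := by
  induction K, hfin using Set.Finite.induction_on with
  | empty => simp [oddSet_empty]
  | @insert e K he hfin ih =>
    obtain ⟨h1, h2⟩ := ih ((Set.subset_insert _ _).trans hK)
    obtain ⟨x, y, hxy⟩ := G.exists_isLink_of_mem_edgeSet (hK (Set.mem_insert _ _))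
    have hf : (({x} : Set α) ∆ {y}).Finite :=
      (Set.finite_singleton x).symmDiff (Set.finite_singleton y)
    rw [Set.ncard_insert_of_notMem he hfin, insert_eq_symmDiff he,
      oddSet_symmDiff hfin (Set.finite_singleton e), oddSet_singleton hxy]
    refine ⟨h1.symmDiff hf, ?_⟩
    have h3 := ncard_symmDiff_add h1 hf
    have h4 := ncard_singleton_symmDiff_le x y
    omega

/-- The handshake lemma for a vertex set that no edge of `K` leaves: every edge contributes two ends
or none to `S`. -/
lemma even_ncard_inter_oddSet {S : Set α} (hK : K ⊆ E(G)) (hfin : K.Finite)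
    (hS : ∀ e ∈ K, ∀ x y, G.IsLink e x y → x ∈ S → y ∈ S) : Even (S ∩ oddSet G K).ncard := by
  induction K, hfin using Set.Finite.induction_on with
  | empty => simp [oddSet_empty]
  | @insert e K he hfin ih =>
    have hK' := (Set.subset_insert e K).trans hK
    have h1 := (finite_oddSet_and_ncard_le hK' hfin).1
    obtain ⟨x, y, hxy⟩ := G.exists_isLink_of_mem_edgeSet (hK (Set.mem_insert _ _))
    have hf : (({x} : Set α) ∆ {y}).Finite :=
      (Set.finite_singleton x).symmDiff (Set.finite_singleton y)
    have hx : x ∈ S ↔ y ∈ S := ⟨hS e (Set.mem_insert _ _) x y hxy,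
      hS e (Set.mem_insert _ _) y x hxy.symm⟩
    rw [insert_eq_symmDiff he, oddSet_symmDiff hfin (Set.finite_singleton e),
      oddSet_singleton hxy, Set.inter_symmDiff_distrib_left,
      even_ncard_symmDiff (h1.inter_of_right S) (hf.inter_of_right S),
      iff_true_left (ih hK' fun f hf => hS f (Set.mem_insert_of_mem _ hf)),
      Set.inter_symmDiff_distrib_left, even_ncard_symmDiff
        ((Set.finite_singleton x).inter_of_right S) ((Set.finite_singleton y).inter_of_right S)]
    by_cases hyS : y ∈ S
    · rw [Set.inter_eq_right.2 (Set.singleton_subset_iff.2 hyS),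
        Set.inter_eq_right.2 (Set.singleton_subset_iff.2 (hx.2 hyS))]
      simp
    · rw [Set.inter_singleton_eq_empty.2 hyS, Set.inter_singleton_eq_empty.2 (fun h => hyS (hx.1 h))]

lemma isGraft_of_isJoin (hV : V(G).Finite) (hE : E(G).Finite) (hT : T ⊆ V(G))
    (hF : IsJoin G T F) : IsGraft G T where
  finite_vertexSet := hV
  finite_edgeSet := hE
  subset := hT
  even_component x _ := by
    obtain ⟨hFE, rfl⟩ := (isJoin_iff hT).1 hF
    exact even_ncard_inter_oddSet hFE (hE.subset hFE) fun e _ y z h hy => hy.tail h.adj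

/-- The edges of a walk counted modulo 2: inner visits cancel and only the two ends stay odd. -/
lemma exists_oddSet_eq_of_reflTransGen {a b : α}
    (h : Relation.ReflTransGen (fun a b => ∃ e ∈ K, G.IsLink e a b) a b) :
    ∃ L ⊆ K, L.Finite ∧ oddSet G L = {a} ∆ {b} := by
  induction h with
  | refl => exact ⟨∅, Set.empty_subset _, Set.finite_empty, by simp [oddSet_empty]⟩
  | @tail b c _ h ih =>
    obtain ⟨L, hLK, hL, hodd⟩ := ih
    obtain ⟨e, he, hl⟩ := h
    refine ⟨L ∆ {e}, ?_, hL.symmDiff (Set.finite_singleton e), ?_⟩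
    · exact Set.symmDiff_subset_union.trans
        (Set.union_subset hLK (Set.singleton_subset_iff.2 he))
    · rw [oddSet_symmDiff hL (Set.finite_singleton e), hodd, oddSet_singleton hl, symmDiff_assoc,
        symmDiff_symmDiff_cancel_left]

lemma component_eq_of_mem (h : y ∈ component G x) : component G y = component G x := by
  ext z
  have hsymm : Relation.ReflTransGen G.Adj y x :=
    Relation.ReflTransGen.stdSymm.symm _ _ h
  exact ⟨fun hz => Relation.ReflTransGen.trans h hz,
    fun hz => Relation.ReflTransGen.trans hsymm hz⟩

/-- Two vertices of `T` in one component can be removed from `T`; toggling the edges of a walk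
between them restores them. -/
lemma IsGraft.exists_isJoin (h : IsGraft G T) : ∃ F, IsJoin G T F := by
  induction hn : T.ncard using Nat.strong_induction_on generalizing T with
  | _ n ih =>
  have hTfin := h.finite_vertexSet.subset h.subset
  rcases T.eq_empty_or_nonempty with rfl | ⟨x, hx⟩
  · exact ⟨∅, (isJoin_iff (Set.empty_subset _)).2 ⟨Set.empty_subset _, oddSet_empty⟩⟩
  have hxc : x ∈ component G x := Relation.ReflTransGen.refl
  obtain ⟨y, ⟨hyc, hyT⟩, hyx⟩ : ∃ y ∈ component G x ∩ T, y ≠ x := by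
    by_contra! hcon
    have : component G x ∩ T = {x} :=
      Set.Subset.antisymm (fun y hy => hcon y hy) (Set.singleton_subset_iff.2 ⟨hxc, hx⟩)
    have h1 := h.even_component x (h.subset hx)
    simp [this] at h1
  have hreach : Relation.ReflTransGen (fun a b => ∃ e ∈ E(G), G.IsLink e a b) x y :=
    Relation.ReflTransGen.mono (fun a b ⟨e, he⟩ => ⟨e, he.edge_mem, he⟩) _ _ hyc
  obtain ⟨L, hLE, hL, hLodd⟩ := exists_oddSet_eq_of_reflTransGen hreach
  have hpair : ({x, y} : Set α) ⊆ T := Set.insert_subset hx (Set.singleton_subset_iff.2 hyT)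
  have hTd : T \ {x, y} = T ∆ {x, y} := by
    rw [Set.symmDiff_def, Set.sdiff_eq_empty.2 hpair, Set.union_empty]
  have hpf : ({x, y} : Set α).Finite := Set.toFinite _
  have hgraft : IsGraft G (T \ {x, y}) := by
    refine ⟨h.finite_vertexSet, h.finite_edgeSet, Set.sdiff_subset.trans h.subset, fun z hz => ?_⟩
    rw [hTd, Set.inter_symmDiff_distrib_left, even_ncard_symmDiff (hTfin.inter_of_right _)
      (hpf.inter_of_right _), iff_true_left (h.even_component z hz)]
    by_cases hzx : x ∈ component G z
    · have hzy : y ∈ component G z := by rw [← component_eq_of_mem hzx]; exact hyc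
      rw [Set.inter_eq_right.2 (Set.insert_subset hzx (Set.singleton_subset_iff.2 hzy)),
        Set.ncard_pair hyx.symm]
      exact even_two
    · have hzy : y ∉ component G z := by
        intro hzy
        rw [← component_eq_of_mem hzy, component_eq_of_mem hyc] at hzx
        exact hzx hxc
      have : component G z ∩ {x, y} = ∅ := by
        ext w
        simp only [Set.mem_inter_iff, Set.mem_insert_iff, Set.mem_singleton_iff,
          Set.mem_empty_iff_false, iff_false]
        rintro ⟨hw, rfl | rfl⟩
        exacts [hzx hw, hzy hw]
      simp [this]
  have hlt : (T \ {x, y}).ncard < n := by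
    rw [← hn]
    exact Set.ncard_lt_ncard ⟨Set.sdiff_subset, fun hsub => (hsub hx).2 (Set.mem_insert _ _)⟩ hTfin
  obtain ⟨F, hF⟩ := ih _ hlt hgraft rfl
  obtain ⟨hFE, hFodd⟩ := (isJoin_iff hgraft.subset).1 hF
  refine ⟨F ∆ L, (isJoin_iff h.subset).2 ⟨Set.symmDiff_subset_union.trans
    (Set.union_subset hFE hLE), ?_⟩⟩
  rw [oddSet_symmDiff (h.finite_edgeSet.subset hFE) hL, hFodd, hLodd, hTd,
    pair_eq_symmDiff hyx.symm, symmDiff_symmDiff_cancel_right]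

lemma nu_le (hF : IsJoin G T F) : nu G T ≤ F.ncard :=
  Nat.sInf_le ⟨F, hF, rfl⟩

lemma IsGraft.exists_isJoin_ncard_eq_nu (h : IsGraft G T) :
    ∃ F, IsJoin G T F ∧ F.ncard = nu G T := by
  obtain ⟨F, hF⟩ := h.exists_isJoin
  exact Nat.sInf_mem (s := {n | ∃ F, IsJoin G T F ∧ F.ncard = n}) ⟨_, F, hF, rfl⟩

end OddSet

/-! ### Adding odd ears preserves near-perfect joins -/

section EarWalk

variable {α β : Type*}
variable {G H P : Graph α β} {T X : Set α} {K L F : Set β} {r : α} {n m : ℕ} {x : ℕ → α} {e : ℕ → β}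

/-- The vertices `x 0, …, x n` and edges `e 0, …, e (n - 1)` of `G` form a path or a circuit that
meets `X` exactly in `x 0` and `x n`, which may coincide. -/
structure IsEarWalk (G : Graph α β) (X : Set α) (n : ℕ) (x : ℕ → α) (e : ℕ → β) : Prop where
  zero_mem : x 0 ∈ X
  last_mem : x n ∈ X
  inner_notMem : ∀ i, 0 < i → i < n → x i ∉ X
  injOn : Set.InjOn x (Set.Ioo 0 n)
  isLink : ∀ i < n, G.IsLink (e i) (x i) (x (i + 1))

lemma IsEarWalk.mono (h : IsEarWalk H X n x e) (hle : H ≤ G) : IsEarWalk G X n x e :=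
  ⟨h.zero_mem, h.last_mem, h.inner_notMem, h.injOn, fun i hi => (h.isLink i hi).mono hle⟩

lemma IsEarWalk.reverse (h : IsEarWalk G X n x e) :
    IsEarWalk G X n (fun i => x (n - i)) (fun i => e (n - 1 - i)) where
  zero_mem := by simpa using h.last_mem
  last_mem := by simpa using h.zero_mem
  inner_notMem i h0 hn := h.inner_notMem _ (by omega) (by omega)
  injOn i hi j hj hij := by
    have := h.injOn (x₁ := n - i) (x₂ := n - j) ⟨by grind, by grind⟩ ⟨by grind, by grind⟩ hij
    grind
  isLink i hi := by
    have := h.isLink (n - 1 - i) (by omega)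
    rw [show n - 1 - i + 1 = n - i by omega, show n - 1 - i = n - (i + 1) by omega] at this
    rw [show n - 1 - i = n - (i + 1) by omega]
    exact this.symm

lemma IsEarWalk.injOn_Ico_zero (h : IsEarWalk G X n x e) : Set.InjOn x (Set.Ico 0 n) := by
  intro i hi j hj hij
  rcases Nat.eq_zero_or_pos i with rfl | hi0 <;> rcases Nat.eq_zero_or_pos j with rfl | hj0
  · rfl
  · exact absurd (hij ▸ h.zero_mem) (h.inner_notMem j hj0 hj.2)
  · exact absurd (hij ▸ h.zero_mem) (h.inner_notMem i hi0 hi.2)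
  · exact h.injOn ⟨hi0, hi.2⟩ ⟨hj0, hj.2⟩ hij

/-- Every second edge, starting at `x a`, matches the `2 * k` consecutive vertices in pairs. -/
lemma exists_oddSet_eq_image (a k : ℕ) (hinj : Set.InjOn x (Set.Ico a (a + 2 * k)))
    (hl : ∀ j < k, G.IsLink (e (a + 2 * j)) (x (a + 2 * j)) (x (a + 2 * j + 1))) :
    ∃ K ⊆ E(G), K.Finite ∧ K.ncard ≤ k ∧ oddSet G K = x '' Set.Ico a (a + 2 * k) := by
  induction k with
  | zero => exact ⟨∅, Set.empty_subset _, Set.finite_empty, by simp, by simp [oddSet_empty]⟩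
  | succ k ih =>
    obtain ⟨K, hKE, hK, hcard, hodd⟩ := ih (hinj.mono (Set.Ico_subset_Ico_right (by omega)))
      fun j hj => hl j (by omega)
    have hlk := hl k (by omega)
    refine ⟨K ∆ {e (a + 2 * k)}, Set.symmDiff_subset_union.trans
      (Set.union_subset hKE (Set.singleton_subset_iff.2 hlk.edge_mem)),
      hK.symmDiff (Set.finite_singleton _), ?_, ?_⟩
    · have := ncard_symmDiff_add hK (Set.finite_singleton (e (a + 2 * k)))
      rw [Set.ncard_singleton] at this
      omega
    · have hne : x (a + 2 * k) ≠ x (a + 2 * k + 1) := fun h => by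
        have := hinj (x₁ := a + 2 * k) (x₂ := a + 2 * k + 1) (by grind) (by grind) h
        omega
      have hunion : Set.Ico a (a + 2 * (k + 1)) =
          Set.Ico a (a + 2 * k) ∪ {a + 2 * k, a + 2 * k + 1} := by
        ext i; grind
      have hdisj : Disjoint (x '' Set.Ico a (a + 2 * k)) {x (a + 2 * k), x (a + 2 * k + 1)} := by
        rw [Set.disjoint_left]
        rintro _ ⟨i, hi, rfl⟩ (h | h)
        · have := hinj (x₁ := i) (x₂ := a + 2 * k) (by grind) (by grind) h
          grind
        · have := hinj (x₁ := i) (x₂ := a + 2 * k + 1) (by grind) (by grind) h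
          grind
      rw [oddSet_symmDiff hK (Set.finite_singleton _), hodd, oddSet_singleton hlk,
        ← pair_eq_symmDiff hne, hdisj.symmDiff_eq_sup, hunion, Set.image_union, Set.image_pair]
      rfl

/-- The missed vertex is old, so the `2 * m` inner vertices of the ear are matched among themselves
by the edges with odd index. -/
lemma IsEarWalk.exists_oddSet_eq_sdiff_of_mem (h : IsEarWalk G X (2 * m + 1) x e) {v : α}
    (hv : v ∈ X) (hFE : F ⊆ E(G)) (hF : F.Finite) (hodd : oddSet G F = X \ {v}) :
    ∃ K ⊆ E(G), K.Finite ∧ K.ncard ≤ F.ncard + m ∧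
      oddSet G K = (X ∪ x '' Set.Ioo 0 (2 * m + 1)) \ {v} := by
  have hIco : Set.Ico 1 (1 + 2 * m) = Set.Ioo 0 (2 * m + 1) := by ext i; grind
  obtain ⟨K, hKE, hK, hcard, hKodd⟩ := exists_oddSet_eq_image (G := G) (x := x) (e := e) 1 m
    (hIco ▸ h.injOn) fun j hj => h.isLink _ (by omega)
  refine ⟨F ∆ K, Set.symmDiff_subset_union.trans (Set.union_subset hFE hKE), hF.symmDiff hK, ?_, ?_⟩
  · have := ncard_symmDiff_add hF hK
    omega
  · have hdisj : Disjoint (x '' Set.Ioo 0 (2 * m + 1)) X := by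
      rw [Set.disjoint_left]
      rintro _ ⟨i, hi, rfl⟩
      exact h.inner_notMem i hi.1 hi.2
    rw [oddSet_symmDiff hF hK, hodd, hKodd, hIco,
      (hdisj.symm.mono_left Set.sdiff_subset).symmDiff_eq_sup, Set.union_sdiff_distrib,
      Set.sdiff_singleton_eq_self (fun h => Set.disjoint_left.1 hdisj h hv)]
    rfl

/-- The vertex `x (2 * i)` splits the ear: `x 0, …, x (2 * i - 1)` and `x (2 * i + 1), …, x (2 * m)`
are both matched by alternate edges. The first piece uses the old vertex `x 0`, which is why `F` has
to miss it. -/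
lemma IsEarWalk.exists_oddSet_eq_sdiff_of_even (h : IsEarWalk G X (2 * m + 1) x e) {i : ℕ}
    (hi : 0 < i) (him : i ≤ m) (hFE : F ⊆ E(G)) (hF : F.Finite) (hodd : oddSet G F = X \ {x 0}) :
    ∃ K ⊆ E(G), K.Finite ∧ K.ncard ≤ F.ncard + m ∧
      oddSet G K = (X ∪ x '' Set.Ioo 0 (2 * m + 1)) \ {x (2 * i)} := by
  obtain ⟨K, hKE, hK, hcard, hKodd⟩ := exists_oddSet_eq_image (G := G) (x := x) (e := e) 0 i
    (h.injOn_Ico_zero.mono (Set.Ico_subset_Ico_right (by omega)))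
    fun j hj => h.isLink _ (by omega)
  obtain ⟨L, hLE, hL, hcard', hLodd⟩ := exists_oddSet_eq_image (G := G) (x := x) (e := e)
    (2 * i + 1) (m - i)
    (h.injOn_Ico_zero.mono (fun j hj => by grind))
    fun j hj => h.isLink _ (by omega)
  refine ⟨F ∆ K ∆ L, Set.symmDiff_subset_union.trans (Set.union_subset
    (Set.symmDiff_subset_union.trans (Set.union_subset hFE hKE)) hLE),
    (hF.symmDiff hK).symmDiff hL, ?_, ?_⟩
  · have := ncard_symmDiff_add hF hK
    have := ncard_symmDiff_add (hF.symmDiff hK) hL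
    omega
  rw [oddSet_symmDiff (hF.symmDiff hK) hL, oddSet_symmDiff hF hK, hodd, hKodd, hLodd, zero_add,
    show 2 * i + 1 + 2 * (m - i) = 2 * m + 1 by omega]
  ext z
  have hinj : ∀ j k, 0 < j → j < 2 * m + 1 → 0 < k → k < 2 * m + 1 → x j = x k → j = k :=
    fun j k h1 h2 h3 h4 => h.injOn ⟨h1, h2⟩ ⟨h3, h4⟩
  have hnot := h.inner_notMem
  have h0 := h.zero_mem
  simp only [Set.mem_symmDiff, Set.mem_sdiff, Set.mem_union, Set.mem_singleton_iff, Set.mem_image,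
    Set.mem_Ico, Set.mem_Ioo]
  by_cases hz : z ∈ X
  · have h1 : (∃ j, (0 ≤ j ∧ j < 2 * i) ∧ x j = z) ↔ z = x 0 := by
      constructor
      · rintro ⟨j, ⟨-, hj⟩, rfl⟩
        rcases Nat.eq_zero_or_pos j with rfl | hj0
        · rfl
        · exact absurd hz (hnot j hj0 (by omega))
      · rintro rfl
        exact ⟨0, by omega, rfl⟩
    have h2 : ¬ ∃ j, (2 * i + 1 ≤ j ∧ j < 2 * m + 1) ∧ x j = z := by
      rintro ⟨j, hj, rfl⟩
      exact hnot j (by omega) (by omega) hz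
    have h3 : z ≠ x (2 * i) := fun h => hnot (2 * i) (by omega) (by omega) (h ▸ hz)
    simp only [h1, h2, hz, h3]
    tauto
  · by_cases hzx : ∃ j, (0 < j ∧ j < 2 * m + 1) ∧ x j = z
    · obtain ⟨j, hj, rfl⟩ := hzx
      have h1 : (∃ k, (0 ≤ k ∧ k < 2 * i) ∧ x k = x j) ↔ j < 2 * i := by
        constructor
        · rintro ⟨k, hk, hkj⟩
          rcases Nat.eq_zero_or_pos k with rfl | hk0
          · exact absurd (hkj ▸ h0) hz
          · have := hinj k j hk0 (by omega) hj.1 hj.2 hkj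
            omega
        · exact fun hlt => ⟨j, by omega, rfl⟩
      have h2 : (∃ k, (2 * i + 1 ≤ k ∧ k < 2 * m + 1) ∧ x k = x j) ↔ 2 * i < j := by
        constructor
        · rintro ⟨k, hk, hkj⟩
          have := hinj k j (by omega) (by omega) hj.1 hj.2 hkj
          omega
        · exact fun hlt => ⟨j, by omega, rfl⟩
      have h3 : x j = x (2 * i) ↔ j = 2 * i :=
        ⟨hinj j (2 * i) hj.1 hj.2 (by omega) (by omega), fun h => h ▸ rfl⟩
      have h4 : ∃ k, (0 < k ∧ k < 2 * m + 1) ∧ x k = x j := ⟨j, hj, rfl⟩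
      simp only [h1, h2, h3, h4, hz]
      grind
    · have h1 : ¬ ∃ k, (0 ≤ k ∧ k < 2 * i) ∧ x k = z := by
        rintro ⟨k, hk, rfl⟩
        rcases Nat.eq_zero_or_pos k with rfl | hk0
        · exact hz h0
        · exact hzx ⟨k, by omega, rfl⟩
      have h2 : ¬ ∃ k, (2 * i + 1 ≤ k ∧ k < 2 * m + 1) ∧ x k = z := by
        rintro ⟨k, hk, rfl⟩
        exact hzx ⟨k, by omega, rfl⟩
      simp only [h1, h2, hzx, hz]
      tauto

lemma IsRoundEar.exists_isEarWalk (h : IsRoundEar P X) :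
    ∃ n x e, 0 < n ∧ IsEarWalk P X n x e ∧ V(P) = x '' Set.Iic n := by
  obtain ⟨⟨f, hf⟩, ⟨s, t, ⟨n, x, e, rfl, rfl, hinj, hV, hE, hl⟩, hX⟩ | ⟨hcirc, s, hX⟩⟩ := h
  · have hn : 0 < n := by
      rw [hE] at hf
      obtain ⟨i, hi, -⟩ := hf
      exact lt_of_le_of_lt (Nat.zero_le i) hi
    refine ⟨n, x, e, hn, ⟨?_, ?_, fun i h0 hn hi => ?_, hinj.mono fun i hi => hi.2.le, hl⟩, hV⟩
    · exact (hX.symm.subset (by simp : x 0 ∈ ({x 0, x n} : Set α))).2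
    · exact (hX.symm.subset (by simp : x n ∈ ({x 0, x n} : Set α))).2
    · rcases hX.subset ⟨hV.symm.subset ⟨i, hn.le, rfl⟩, hi⟩ with h | h
      · exact h0.ne' (hinj hn.le (Nat.zero_le n) h)
      · exact hn.ne (hinj hn.le (le_refl n) h)
  · obtain ⟨n, x, e, hn, hclose, hinj, -, hV, hE, hl⟩ := hcirc
    have hs := hX.symm.subset (rfl : s ∈ ({s} : Set α))
    rw [hV] at hs
    obtain ⟨⟨a, ha, has⟩, hsX⟩ := hs
    have ha : a < n := ha
    have hmod : ∀ i, (a + i) % n < n := fun i => Nat.mod_lt _ hn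
    have hmodinj : ∀ i < n, ∀ j < n, (a + i) % n = (a + j) % n → i = j := fun i hi j hj hij =>
      Nat.ModEq.eq_of_lt_of_lt (Nat.ModEq.add_left_cancel' a hij) hi hj
    -- The circuit is rotated so that its vertex in `X`, at position `a`, becomes both start and
    -- end.
    refine ⟨n, fun i => x ((a + i) % n), fun i => e ((a + i) % n), hn,
      ⟨?_, ?_, fun i h0 hi hmem => ?_, fun i hi j hj hij => ?_, fun i hi => ?_⟩, ?_⟩
    · simpa [Nat.mod_eq_of_lt ha, has] using hsX
    · simpa [Nat.mod_eq_of_lt ha, has] using hsX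
    · have h1 : x ((a + i) % n) = s := hX.subset ⟨hV.symm.subset ⟨_, hmod i, rfl⟩, hmem⟩
      rw [← has] at h1
      have h2 := hinj (hmod i) ha h1
      refine h0.ne' (hmodinj i hi 0 hn ?_)
      rw [h2, add_zero, Nat.mod_eq_of_lt ha]
    · exact hmodinj i hi.2 j hj.2 (hinj (hmod i) (hmod j) hij)
    · have h1 := hl _ (hmod i)
      have h2 : x ((a + i) % n + 1) = x ((a + (i + 1)) % n) := by
        rw [← add_assoc, Nat.add_mod (a + i) 1 n]
        have h3 := hmod i
        rcases Nat.lt_or_ge ((a + i) % n + 1) n with h4 | h4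
        · rw [Nat.mod_eq_of_lt (a := 1) (by omega), Nat.mod_eq_of_lt h4]
        · have h5 : (a + i) % n + 1 = n := by omega
          rw [Nat.add_mod_mod, h5, hclose, Nat.mod_self]
      rw [← h2]
      exact h1
    · rw [hV]
      refine Set.Subset.antisymm ?_ ?_
      · rintro _ ⟨q, hq, rfl⟩
        have hq : q < n := hq
        refine ⟨(q + (n - a)) % n, (Nat.mod_lt _ hn).le, ?_⟩
        simp only
        rw [Nat.add_mod_mod, show a + (q + (n - a)) = q + n by omega, Nat.add_mod_right,
          Nat.mod_eq_of_lt hq]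
      · rintro _ ⟨i, -, rfl⟩
        exact ⟨_, hmod i, rfl⟩

lemma IsEarWalk.vertexSet_sdiff (h : IsEarWalk P X n x e) (hV : V(P) = x '' Set.Iic n) :
    V(P) \ X = x '' Set.Ioo 0 n := by
  rw [hV]
  ext z
  constructor
  · rintro ⟨⟨i, hi, rfl⟩, hz⟩
    have hi : i ≤ n := hi
    refine ⟨i, ⟨Nat.pos_of_ne_zero ?_, lt_of_le_of_ne hi ?_⟩, rfl⟩
    · rintro rfl; exact hz h.zero_mem
    · rintro rfl; exact hz h.last_mem
  · rintro ⟨i, hi, rfl⟩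
    exact ⟨⟨i, hi.2.le, rfl⟩, h.inner_notMem i hi.1 hi.2⟩

/-- The ear is connected, so its `n - 1` inner vertices form the part of `V(P) \ X` in a single
component, and their number is even. -/
lemma IsEarWalk.odd_of_isGraft (h : IsEarWalk P X n x e) (hn : 0 < n) (hV : V(P) = x '' Set.Iic n)
    (hP : IsGraft P (V(P) \ X)) : Odd n := by
  have himage := h.vertexSet_sdiff hV
  have hreach : ∀ i ≤ n, x i ∈ component P (x 0) := by
    intro i
    induction i with
    | zero => exact fun _ => Relation.ReflTransGen.refl
    | succ i ih => exact fun hi => (ih (by omega)).tail (h.isLink i (by omega)).adj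
  have hcomp : component P (x 0) ∩ (V(P) \ X) = x '' Set.Ioo 0 n := by
    rw [himage, Set.inter_eq_right]
    rintro _ ⟨i, hi, rfl⟩
    exact hreach i hi.2.le
  have := hP.even_component (x 0) (hV.symm.subset ⟨0, Nat.zero_le n, rfl⟩)
  rw [hcomp, h.injOn.ncard_image, Set.ncard_eq_toFinset_card', Set.toFinset_Ioo,
    Nat.card_Ioo] at this
  grind

lemma le_graphSum_left (hc : G.Compatible P) : G ≤ graphSum G P hc :=
  ⟨Set.subset_union_left, fun _ _ _ h => Or.inl h⟩

lemma le_graphSum_right (hc : G.Compatible P) : P ≤ graphSum G P hc :=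
  ⟨Set.subset_union_right, fun _ _ _ h => Or.inr h⟩

/-- A finite graph with root `r` in which each set `V(G) \ {v}` is the set of odd vertices of
some edge set with at most `(|V(G)| - 1) / 2` edges. -/
structure HasNearPerfectJoins (G : Graph α β) (r : α) : Prop where
  finite_vertexSet : V(G).Finite
  finite_edgeSet : E(G).Finite
  root_mem : r ∈ V(G)
  exists_oddSet_eq : ∀ v ∈ V(G), ∃ F ⊆ E(G), 2 * F.ncard + 1 ≤ V(G).ncard ∧ oddSet G F = V(G) \ {v}

lemma HasNearPerfectJoins.graphSum (h : HasNearPerfectJoins G r) (hc : G.Compatible P)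
    (hear : IsRoundEar P V(G)) (hP : IsGraft P (V(P) \ V(G))) :
    HasNearPerfectJoins (graphSum G P hc) r := by
  obtain ⟨n, x, e, hn, hwalk, hVP⟩ := hear.exists_isEarWalk
  obtain ⟨m, rfl⟩ := hwalk.odd_of_isGraft hn hVP hP
  have himage := hwalk.vertexSet_sdiff hVP
  have hV : V(Graft.graphSum G P hc) = V(G) ∪ x '' Set.Ioo 0 (2 * m + 1) := by
    rw [← himage, Set.union_sdiff_self]
    rfl
  have hfinV : V(Graft.graphSum G P hc).Finite := h.finite_vertexSet.union hP.finite_vertexSet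
  have hfinE : E(Graft.graphSum G P hc).Finite := h.finite_edgeSet.union hP.finite_edgeSet
  have hcard : V(Graft.graphSum G P hc).ncard = V(G).ncard + 2 * m := by
    rw [hV, Set.ncard_union_eq _ h.finite_vertexSet (Set.toFinite _),
      hwalk.injOn.ncard_image,
      Set.ncard_eq_toFinset_card' (Set.Ioo 0 (2 * m + 1)), Set.toFinset_Ioo,
      Nat.card_Ioo]
    · simp
    · rw [← himage]
      exact Set.disjoint_sdiff_right
  have hle := le_graphSum_left hc
  have hwalk' := hwalk.mono (le_graphSum_right hc)
  refine ⟨hfinV, hfinE, hle.vertexSet_mono h.root_mem, fun v hv => ?_⟩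
  -- Here `w` is the vertex missed by the old join. It is `v` itself if `v` is old, and otherwise
  -- the end of the ear at odd distance complement from `v`: `x 0` for even index, `x (2 * m + 1)`
  -- for odd index, where the walk is reversed.
  have key : ∀ w ∈ V(G), (∀ F ⊆ E(Graft.graphSum G P hc), F.Finite →
      oddSet (Graft.graphSum G P hc) F = V(G) \ {w} → ∃ K ⊆ E(Graft.graphSum G P hc), K.Finite ∧
        K.ncard ≤ F.ncard + m ∧ oddSet (Graft.graphSum G P hc) K =
          (V(G) ∪ x '' Set.Ioo 0 (2 * m + 1)) \ {v}) → ∃ F ⊆ E(Graft.graphSum G P hc),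
      2 * F.ncard + 1 ≤ V(Graft.graphSum G P hc).ncard ∧
        oddSet (Graft.graphSum G P hc) F = V(Graft.graphSum G P hc) \ {v} := by
    intro w hw hext
    obtain ⟨F, hFE, hF, hodd⟩ := h.exists_oddSet_eq w hw
    obtain ⟨K, hKE, -, hK, hKodd⟩ := hext F (hFE.trans hle.edgeSet_mono)
      (h.finite_edgeSet.subset hFE) (by rw [oddSet_of_le hle hFE, hodd])
    exact ⟨K, hKE, by omega, by rw [hKodd, hV]⟩
  by_cases hvG : v ∈ V(G)
  · exact key v hvG fun F hFE hF hodd => hwalk'.exists_oddSet_eq_sdiff_of_mem hvG hFE hF hodd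
  obtain ⟨i, hi, rfl⟩ := (hV.subset hv).resolve_left hvG
  rcases Nat.even_or_odd' i with ⟨k, rfl | rfl⟩
  · exact key (x 0) hwalk.zero_mem fun F hFE hF hodd =>
      hwalk'.exists_oddSet_eq_sdiff_of_even (by grind) (by grind) hFE hF hodd
  · refine key (x (2 * m + 1)) hwalk.last_mem fun F hFE hF hodd => ?_
    have hrev := hwalk'.reverse.exists_oddSet_eq_sdiff_of_even (i := m - k) (F := F) (by grind)
      (by grind) hFE hF (by simpa using hodd)
    have himg : (fun i => x (2 * m + 1 - i)) '' Set.Ioo 0 (2 * m + 1) =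
        x '' Set.Ioo 0 (2 * m + 1) := by
      refine Set.Subset.antisymm ?_ ?_
      · rintro _ ⟨j, hj, rfl⟩
        exact ⟨_, by grind, rfl⟩
      · rintro _ ⟨j, hj, rfl⟩
        exact ⟨2 * m + 1 - j, by grind, by grind⟩
    rw [himg, show 2 * m + 1 - 2 * (m - k) = 2 * k + 1 by grind] at hrev
    exact hrev

lemma sdiff_singleton_symmDiff_sdiff {A B : Set α} (hr : r ∈ A) :
    (A \ {r}) ∆ (B \ A) = (A ∪ B) \ {r} := by
  ext z
  simp only [Set.mem_symmDiff, Set.mem_sdiff, Set.mem_union, Set.mem_singleton_iff]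
  by_cases hz : z = r
  · subst hz; tauto
  · tauto

lemma EarFamily.eq_sdiff_and_hasNearPerfectJoins (h : EarFamily r G T) :
    T = V(G) \ {r} ∧ HasNearPerfectJoins G r := by
  induction h with
  | single =>
    refine ⟨by simp, by simp, by simp, by simp, fun v hv => ?_⟩
    have hv : v = r := by simpa using hv
    exact ⟨∅, Set.empty_subset _, by simp, by simp [oddSet_empty, hv]⟩
  | addEar G T P T' hG hP hc hear hinner hbonds ih =>
    obtain ⟨rfl, ih⟩ := ih
    have hT' : T' = V(P) \ V(G) := by
      rw [Set.sdiff_self_inter] at hinner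
      refine Set.Subset.antisymm (fun z hz => ⟨hP.subset hz, fun hzG => ?_⟩) hinner
      exact hbonds.subset ⟨⟨hP.subset hz, hzG⟩, hz⟩
    subst hT'
    refine ⟨?_, ih.graphSum hc hear hP⟩
    exact sdiff_singleton_symmDiff_sdiff ih.root_mem

lemma sdiff_singleton_symmDiff_pair {V : Set α} {r v : α} (hr : r ∈ V) (hv : v ∈ V) (hne : v ≠ r) :
    (V \ {r}) ∆ {r, v} = V \ {v} := by
  ext z
  simp only [Set.mem_symmDiff, Set.mem_sdiff, Set.mem_insert_iff, Set.mem_singleton_iff]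
  by_cases h1 : z = r <;> by_cases h2 : z = v <;> grind

lemma HasNearPerfectJoins.isFactorCritical (h : HasNearPerfectJoins G r) :
    IsFactorCritical G (V(G) \ {r}) r := by
  have hjoin : ∀ v ∈ V(G), IsGraft G (V(G) \ {v}) ∧ 2 * nu G (V(G) \ {v}) + 1 = V(G).ncard := by
    intro v hv
    obtain ⟨F, hFE, hcard, hodd⟩ := h.exists_oddSet_eq v hv
    have hF : IsJoin G (V(G) \ {v}) F := (isJoin_iff Set.sdiff_subset).2 ⟨hFE, hodd⟩
    have hgraft := isGraft_of_isJoin h.finite_vertexSet h.finite_edgeSet Set.sdiff_subset hF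
    refine ⟨hgraft, ?_⟩
    -- The bound from `F` and the count of odd vertices of a minimum join `K` together pin `nu` to
    -- `(|V(G)| - 1) / 2`.
    have h1 := nu_le hF
    obtain ⟨K, hK, hKcard⟩ := hgraft.exists_isJoin_ncard_eq_nu
    obtain ⟨hKE, hKodd⟩ := (isJoin_iff Set.sdiff_subset).1 hK
    have h2 := (finite_oddSet_and_ncard_le hKE (h.finite_edgeSet.subset hKE)).2
    have h3 := Set.ncard_sdiff_singleton_add_one hv h.finite_vertexSet
    rw [hKodd] at h2
    omega
  refine ⟨(hjoin r h.root_mem).1, h.root_mem, fun v hv hne => ?_, fun v hv hne => ?_⟩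
  · rw [sdiff_singleton_symmDiff_pair h.root_mem hv hne]
    exact (hjoin v hv).1
  · rw [sdiff_singleton_symmDiff_pair h.root_mem hv hne]
    have h1 := (hjoin v hv).2
    have h2 := (hjoin r h.root_mem).2
    omega

end EarWalk

/-! ### Minimum joins of a factor-critical graft are near-perfect matchings -/

section Matching

variable {α β : Type*}
variable {G : Graph α β} {T : Set α} {F J : Set β} {f f' : β} {r u v w : α}

/-- With `{r} ∆ {v}` in place of `{r, v}` the case `v = r` needs no separate treatment later. -/
lemma IsFactorCritical.isGraft_and_nu_eq (h : IsFactorCritical G T r) (hv : v ∈ V(G)) :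
    IsGraft G (T ∆ ({r} ∆ {v})) ∧ nu G (T ∆ ({r} ∆ {v})) = nu G T := by
  by_cases hvr : v = r
  · subst hvr
    rw [symmDiff_self, symmDiff_bot]
    exact ⟨h.isGraft, rfl⟩
  · rw [← pair_eq_symmDiff (Ne.symm hvr)]
    exact ⟨h.isGraft_symmDiff v hv hvr, (h.nu_eq v hv hvr).symm⟩

lemma IsFactorCritical.exists_min (h : IsFactorCritical G T r) (hv : v ∈ V(G)) :
    ∃ F ⊆ E(G), oddSet G F = T ∆ ({r} ∆ {v}) ∧ F.ncard = nu G T := by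
  obtain ⟨hg, hnu⟩ := h.isGraft_and_nu_eq hv
  obtain ⟨F, hF, hcard⟩ := hg.exists_isJoin_ncard_eq_nu
  obtain ⟨hFE, hodd⟩ := (isJoin_iff hg.subset).1 hF
  exact ⟨F, hFE, hodd, hcard.trans hnu⟩

lemma IsFactorCritical.nu_le_ncard (h : IsFactorCritical G T r) (hv : v ∈ V(G)) (hFE : F ⊆ E(G))
    (hodd : oddSet G F = T ∆ ({r} ∆ {v})) : nu G T ≤ F.ncard := by
  obtain ⟨hg, hnu⟩ := h.isGraft_and_nu_eq hv
  rw [← hnu]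
  exact nu_le ((isJoin_iff hg.subset).2 ⟨hFE, hodd⟩)

/-- Deleting an edge `f` from `v` to `y` would leave a join for `T ∆ ({r} ∆ {y})` with fewer than
`nu G T` edges. -/
lemma IsFactorCritical.not_isNonloopAt (h : IsFactorCritical G T r) (hFE : F ⊆ E(G))
    (hodd : oddSet G F = T ∆ ({r} ∆ {v})) (hcard : F.ncard = nu G T) (hf : f ∈ F) :
    ¬ G.IsNonloopAt f v := by
  rintro ⟨y, -, hl⟩
  have hF := h.isGraft.finite_edgeSet.subset hFE
  have h1 := ncard_symmDiff_add hF (Set.finite_singleton f)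
  rw [Set.inter_eq_right.2 (Set.singleton_subset_iff.2 hf), Set.ncard_singleton] at h1
  have h2 := h.nu_le_ncard (F := F ∆ {f}) hl.right_mem (Set.symmDiff_subset_union.trans
    (Set.union_subset hFE (Set.singleton_subset_iff.2 (hFE hf)))) (by
      rw [oddSet_symmDiff hF (Set.finite_singleton f), hodd, oddSet_singleton hl, symmDiff_assoc,
        symmDiff_assoc, symmDiff_symmDiff_cancel_left])
  omega

lemma not_mem_oddSet (h : ∀ f ∈ F, ¬ G.IsNonloopAt f v) : v ∉ oddSet G F := by
  have : {e | G.IsNonloopAt e v} ∩ F = ∅ :=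
    Set.eq_empty_of_forall_notMem fun e he => h e he.2 he.1
  simp [oddSet, this]

lemma IsFactorCritical.eq_sdiff (h : IsFactorCritical G T r) : T = V(G) \ {r} := by
  have key : ∀ v ∈ V(G), v ∉ T ∆ ({r} ∆ {v}) := by
    intro v hv
    obtain ⟨F, hFE, hodd, hcard⟩ := h.exists_min hv
    rw [← hodd]
    exact not_mem_oddSet fun f hf => h.not_isNonloopAt hFE hodd hcard hf
  ext v
  constructor
  · intro hv
    refine ⟨h.isGraft.subset hv, fun hvr => ?_⟩
    rw [Set.mem_singleton_iff] at hvr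
    subst hvr
    exact key v h.root_mem (by rwa [symmDiff_self, symmDiff_bot])
  · rintro ⟨hv, hvr⟩
    by_contra hvT
    exact key v hv (Or.inr ⟨Or.inr ⟨rfl, hvr⟩, hvT⟩)

lemma IsFactorCritical.change_root (h : IsFactorCritical G T r) (hw : w ∈ V(G)) (hwr : w ≠ r) :
    IsFactorCritical G (T ∆ {r, w}) w := by
  have key : ∀ v ≠ w, T ∆ {r, w} ∆ {w, v} = T ∆ ({r} ∆ {v}) := fun v hv => by
    rw [pair_eq_symmDiff hwr.symm, pair_eq_symmDiff hv.symm, symmDiff_assoc, symmDiff_assoc,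
      symmDiff_symmDiff_cancel_left]
  refine ⟨h.isGraft_symmDiff w hw hwr, hw, fun v hv hvw => ?_, fun v hv hvw => ?_⟩
  · rw [key v hvw]
    exact (h.isGraft_and_nu_eq hv).1
  · rw [key v hvw, ← h.nu_eq w hw hwr, (h.isGraft_and_nu_eq hv).2]

/-- Without `f` the odd set is `{r} ∆ {u}`. The component of `u` in `J \ {f}` contains an even
number of odd vertices, hence also `r`. -/
lemma reflTransGen_root_of_bridge (hJE : J ⊆ E(G)) (hJ : J.Finite)
    (hodd : oddSet G J = {r} ∆ {v}) (hf : f ∈ J) (hl : G.IsLink f v u) :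
    Relation.ReflTransGen (fun a b => ∃ e ∈ J \ {f}, G.IsLink e a b) u r := by
  set S : Set α :=
    {z | Relation.ReflTransGen (fun a b => ∃ e ∈ J \ {f}, G.IsLink e a b) u z} with hS
  have heven := even_ncard_inter_oddSet (G := G) (K := J \ {f}) (S := S)
    (Set.sdiff_subset.trans hJE) hJ.sdiff fun e he x y hxy hx => hx.tail ⟨e, he, hxy⟩
  have hsd : J \ {f} = J ∆ {f} := by
    rw [Set.symmDiff_def, Set.sdiff_eq_empty.2 (Set.singleton_subset_iff.2 hf), Set.union_empty]
  rw [hsd, oddSet_symmDiff hJ (Set.finite_singleton f), hodd, oddSet_singleton hl, symmDiff_assoc,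
    symmDiff_symmDiff_cancel_left] at heven
  by_contra hr
  have hu : u ∈ S := Relation.ReflTransGen.refl
  have hr : r ∉ S := hr
  have : S ∩ ({r} ∆ {u}) = {u} := by
    rw [Set.inter_symmDiff_distrib_left, Set.inter_singleton_eq_empty.2 hr,
      Set.inter_eq_right.2 (Set.singleton_subset_iff.2 hu)]
    simp
  rw [this, Set.ncard_singleton] at heven
  exact absurd heven (by decide)

lemma exists_even_subset_of_reflTransGen (hf : f ∈ J) (hl : G.IsLink f v u) (huv : u ≠ v)
    (h : Relation.ReflTransGen (fun a b => ∃ e ∈ J \ {f}, G.IsLink e a b) u v) :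
    ∃ C ⊆ J, oddSet G C = ∅ ∧ ∃ g ∈ C, G.IsNonloopAt g v := by
  obtain ⟨L, hLJ, hL, hodd⟩ := exists_oddSet_eq_of_reflTransGen h
  have hfL : f ∉ L := fun hfL => (hLJ hfL).2 rfl
  refine ⟨insert f L, Set.insert_subset hf (hLJ.trans Set.sdiff_subset), ?_,
    f, Set.mem_insert _ _, u, huv, hl⟩
  rw [insert_eq_symmDiff hfL, oddSet_symmDiff hL (Set.finite_singleton f), hodd,
    oddSet_singleton hl.symm, symmDiff_self, Set.bot_eq_empty]

/-- If only `r` and `v` have odd degree in `J` and `v` has degree at least two, then some edge at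
`v` lies in a subset of `J` all of whose degrees are even. -/
lemma exists_even_subset (hJE : J ⊆ E(G)) (hJ : J.Finite) (hodd : oddSet G J = {r} ∆ {v})
    (hf : f ∈ J) (hf' : f' ∈ J) (hne : f ≠ f') (hfv : G.IsNonloopAt f v)
    (hfv' : G.IsNonloopAt f' v) :
    ∃ C ⊆ J, oddSet G C = ∅ ∧ ∃ g ∈ C, G.IsNonloopAt g v := by
  obtain ⟨u, huv, hl⟩ := hfv
  obtain ⟨u', huv', hl'⟩ := hfv'
  by_cases hb : Relation.ReflTransGen (fun a b => ∃ e ∈ J \ {f}, G.IsLink e a b) u v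
  · exact exists_even_subset_of_reflTransGen hf hl huv hb
  by_cases hb' : Relation.ReflTransGen (fun a b => ∃ e ∈ J \ {f'}, G.IsLink e a b) u' v
  · exact exists_even_subset_of_reflTransGen hf' hl' huv' hb'
  exfalso
  have h1 := reflTransGen_root_of_bridge hJE hJ hodd hf hl
  have h2 := reflTransGen_root_of_bridge hJE hJ hodd hf' hl'
  -- A walk from `u'` that avoids `f'` also avoids `f`, since using `f` would bring it to `v`,
  -- against `hb'`. So `u` reaches `r`, then `u'`, then `v` through `f'`, all without `f`,
  -- contradicting `hb`.
  have h3 : ∀ z, Relation.ReflTransGen (fun a b => ∃ e ∈ J \ {f'}, G.IsLink e a b) u' z →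
      Relation.ReflTransGen (fun a b => ∃ e ∈ J \ {f}, G.IsLink e a b) z u' := by
    intro z hz
    induction hz with
    | refl => exact Relation.ReflTransGen.refl
    | @tail a b ha hab ih =>
      obtain ⟨e, he, hle⟩ := hab
      refine Relation.ReflTransGen.head ⟨e, ⟨he.1, fun hef => ?_⟩, hle.symm⟩ ih
      rw [Set.mem_singleton_iff] at hef
      subst hef
      rcases hl.left_eq_or_eq hle with rfl | rfl
      · exact hb' ha
      · exact hb' (ha.tail ⟨_, he, hle⟩)
  exact hb ((h1.trans (h3 r h2)).tail ⟨f', ⟨hf', fun h => hne h.symm⟩, hl'.symm⟩)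

/-- Let `K` be a minimum join avoiding `v`. Two edges of `F` at `v` would put an edge at `v` into an
even set `C ⊆ F ∆ K`. Exchanging along `C` keeps both joins valid, so by minimality `C` has equally
many edges in `F` and in `K`; then `K ∆ C` is also minimum but has an edge at `v`. -/
lemma IsFactorCritical.eq_of_isNonloopAt (h : IsFactorCritical G T r) (hFE : F ⊆ E(G))
    (hodd : oddSet G F = T) (hcard : F.ncard = nu G T) (hf : f ∈ F) (hf' : f' ∈ F)
    (hfv : G.IsNonloopAt f v) (hfv' : G.IsNonloopAt f' v) : f = f' := by
  by_contra hne
  have hv := hfv.vertex_mem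
  obtain ⟨K, hKE, hKodd, hKcard⟩ := h.exists_min hv
  have hK0 : ∀ g ∈ K, ¬ G.IsNonloopAt g v := fun g hg => h.not_isNonloopAt hKE hKodd hKcard hg
  have hF := h.isGraft.finite_edgeSet.subset hFE
  have hK := h.isGraft.finite_edgeSet.subset hKE
  obtain ⟨C, hCJ, hCodd, g, hgC, hgv⟩ := exists_even_subset (J := F ∆ K) (r := r)
    (Set.symmDiff_subset_union.trans (Set.union_subset hFE hKE)) (hF.symmDiff hK)
    (by rw [oddSet_symmDiff hF hK, hodd, hKodd, symmDiff_symmDiff_cancel_left])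
    (Or.inl ⟨hf, fun h => hK0 _ h hfv⟩) (Or.inl ⟨hf', fun h => hK0 _ h hfv'⟩) hne hfv hfv'
  have hCE : C ⊆ E(G) :=
    hCJ.trans (Set.symmDiff_subset_union.trans (Set.union_subset hFE hKE))
  have hC := h.isGraft.finite_edgeSet.subset hCE
  have hFCE : F ∆ C ⊆ E(G) := Set.symmDiff_subset_union.trans (Set.union_subset hFE hCE)
  have hKCE : K ∆ C ⊆ E(G) := Set.symmDiff_subset_union.trans (Set.union_subset hKE hCE)
  have hFCodd : oddSet G (F ∆ C) = T := by
    rw [oddSet_symmDiff hF hC, hodd, hCodd, ← Set.bot_eq_empty, symmDiff_bot]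
  have hKCodd : oddSet G (K ∆ C) = T ∆ ({r} ∆ {v}) := by
    rw [oddSet_symmDiff hK hC, hKodd, hCodd, ← Set.bot_eq_empty, symmDiff_bot]
  have h1 := nu_le ((isJoin_iff h.isGraft.subset).2 ⟨hFCE, hFCodd⟩)
  have h2 := h.nu_le_ncard hv hKCE hKCodd
  have h3 := ncard_symmDiff_add hF hC
  have h4 := ncard_symmDiff_add hK hC
  have h5 := Set.ncard_inter_add_ncard_sdiff_eq_ncard C F hC
  have h6 : C \ F = K ∩ C := by
    ext z
    have := fun hz => @hCJ z hz
    simp only [Set.mem_symmDiff] at this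
    simp only [Set.mem_sdiff, Set.mem_inter_iff]
    tauto
  rw [h6, Set.inter_comm C F] at h5
  exact h.not_isNonloopAt hKCE hKCodd (by omega) (Or.inr ⟨hgC, fun hg => hK0 g hg hgv⟩) hgv

/-- `m` maps each vertex to its partner in a matching that covers all vertices except `r`. -/
structure IsNearMatching (G : Graph α β) (r : α) (m : α → α) : Prop where
  map_mem : ∀ v ∈ V(G), m v ∈ V(G)
  map_map : ∀ v ∈ V(G), m (m v) = v
  map_root : m r = r
  map_ne : ∀ v ∈ V(G), v ≠ r → m v ≠ v
  adj : ∀ v ∈ V(G), v ≠ r → G.Adj v (m v)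

lemma IsFactorCritical.exists_isNearMatching (h : IsFactorCritical G T r) :
    ∃ m, IsNearMatching G r m := by
  obtain ⟨F, hFE, hodd, hcard⟩ := h.exists_min h.root_mem
  have hroot : ∀ g ∈ F, ¬ G.IsNonloopAt g r :=
    fun g hg => h.not_isNonloopAt hFE hodd hcard hg
  rw [symmDiff_self, symmDiff_bot] at hodd
  -- The partner is the other end of a join edge. The default value `v` at the remaining vertices
  -- makes `r` a fixed point.
  have hex : ∀ v, ∃ y, (v ∈ V(G) ∧ v ≠ r → y ≠ v ∧ ∃ f ∈ F, G.IsLink f v y) ∧ (v = r → y = r) := by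
    intro v
    by_cases hv : v ∈ V(G) ∧ v ≠ r
    · have hvT : v ∈ oddSet G F := by
        rw [hodd, h.eq_sdiff]
        exact hv
      by_contra! hcon
      refine not_mem_oddSet (fun f hf => ?_) hvT
      rintro ⟨y, hy, hl⟩
      exact hv.2 (hcon y fun _ => ⟨hy, f, hf, hl⟩).1
    · exact ⟨v, fun h => absurd h hv, id⟩
  choose m hm hmr using hex
  have hmap_ne : ∀ v ∈ V(G), v ≠ r → m v ≠ r := by
    intro v hv hvr hmv
    obtain ⟨hne, f, hf, hl⟩ := hm v ⟨hv, hvr⟩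
    exact hroot f hf ⟨v, hvr, hmv ▸ hl.symm⟩
  refine ⟨m, fun v hv => ?_, fun v hv => ?_, hmr r rfl, fun v hv hvr => (hm v ⟨hv, hvr⟩).1,
    fun v hv hvr => ?_⟩
  · by_cases hvr : v = r
    · rw [hmr v hvr]
      exact h.root_mem
    · obtain ⟨-, f, -, hl⟩ := hm v ⟨hv, hvr⟩
      exact hl.right_mem
  · by_cases hvr : v = r
    · rw [hmr v hvr, hmr r rfl, hvr]
    · obtain ⟨hne, f, hf, hl⟩ := hm v ⟨hv, hvr⟩
      obtain ⟨hne', f', hf', hl'⟩ := hm (m v) ⟨hl.right_mem, hmap_ne v hv hvr⟩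
      have := h.eq_of_isNonloopAt hFE hodd hcard hf hf' ⟨v, hne.symm, hl.symm⟩ ⟨_, hne', hl'⟩
      subst this
      exact hl'.right_unique hl.symm
  · obtain ⟨-, f, -, hl⟩ := hm v ⟨hv, hvr⟩
    exact hl.adj

/-- If `v` were outside the component of `r`, toggling `{r, v}` would change the parity of `T` on
that component. -/
lemma IsFactorCritical.reflTransGen_adj (h : IsFactorCritical G T r) (hv : v ∈ V(G)) :
    Relation.ReflTransGen G.Adj r v := by
  by_cases hvr : v = r
  · subst hvr; exact Relation.ReflTransGen.refl
  have hT : T.Finite := h.isGraft.finite_vertexSet.subset h.isGraft.subset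
  have h1 := h.isGraft.even_component r h.root_mem
  have h2 := (h.isGraft_symmDiff v hv hvr).even_component r h.root_mem
  rw [Set.inter_symmDiff_distrib_left, even_ncard_symmDiff (hT.inter_of_right _)
    ((Set.toFinite _).inter_of_right _), iff_true_left h1] at h2
  by_contra hcon
  have hr : r ∈ component G r := Relation.ReflTransGen.refl
  have hvc : v ∉ component G r := hcon
  have : component G r ∩ {r, v} = {r} := by
    rw [pair_eq_symmDiff (Ne.symm hvr), Set.inter_symmDiff_distrib_left,
      Set.inter_singleton_eq_empty.2 hvc,
      Set.inter_eq_right.2 (Set.singleton_subset_iff.2 hr)]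
    simp
  rw [this, Set.ncard_singleton] at h2
  exact absurd h2 (by decide)

end Matching

/-! ### Building a factor-critical graft from odd ears -/

section EarConstruction

variable {α β : Type*}
variable {G H : Graph α β} {T X : Set α} {r w : α} {k n : ℕ} {x : ℕ → α} {e : ℕ → β}
  {m p : α → α}

/-- The subgraph of `G` formed by the vertices `x 0, …, x n` and the edges `e 0, …, e (n - 1)`. -/
def walkGraph (G : Graph α β) (n : ℕ) (x : ℕ → α) (e : ℕ → β)
    (h : ∀ i < n, G.IsLink (e i) (x i) (x (i + 1))) : Graph α β where
  vertexSet := x '' Set.Iic n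
  edgeSet := e '' Set.Iio n
  IsLink f a b := f ∈ e '' Set.Iio n ∧ G.IsLink f a b
  isLink_symm := fun _ _ => ⟨fun _ _ hab => ⟨hab.1, hab.2.symm⟩⟩
  eq_or_eq_of_isLink_of_isLink := fun _ _ _ _ _ h₁ h₂ => h₁.2.left_eq_or_eq h₂.2
  edge_mem_iff_exists_isLink := fun f => by
    constructor
    · rintro ⟨i, hi, rfl⟩
      exact ⟨_, _, ⟨i, hi, rfl⟩, h i hi⟩
    · rintro ⟨_, _, hf, -⟩
      exact hf
  left_mem_of_isLink := by
    rintro _ a b ⟨⟨i, hi, rfl⟩, hl⟩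
    rcases hl.left_eq_or_eq (h i hi) with rfl | rfl
    · exact ⟨i, Nat.le_of_lt hi, rfl⟩
    · exact ⟨i + 1, hi, rfl⟩

lemma walkGraph_le (hn : 0 < n) (h : ∀ i < n, G.IsLink (e i) (x i) (x (i + 1))) :
    walkGraph G n x e h ≤ G := by
  refine ⟨?_, fun _ _ _ hl => hl.2⟩
  rintro _ ⟨i, hi, rfl⟩
  have hi : i ≤ n := hi
  rcases hi.lt_or_eq with hi | rfl
  · exact (h i hi).left_mem
  · have := (h (i - 1) (by omega)).right_mem
    rwa [Nat.sub_add_cancel hn] at this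

lemma IsEarWalk.walkGraph (h : IsEarWalk G X n x e) :
    IsEarWalk (walkGraph G n x e h.isLink) X n x e :=
  ⟨h.zero_mem, h.last_mem, h.inner_notMem, h.injOn, fun i hi => ⟨⟨i, hi, rfl⟩, h.isLink i hi⟩⟩

lemma IsEarWalk.inter_eq (h : IsEarWalk G X n x e) : x '' Set.Iic n ∩ X = {x 0, x n} := by
  refine Set.Subset.antisymm ?_ (Set.insert_subset ⟨⟨0, Nat.zero_le n, rfl⟩, h.zero_mem⟩
    (Set.singleton_subset_iff.2 ⟨⟨n, le_refl n, rfl⟩, h.last_mem⟩))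
  rintro _ ⟨⟨i, hi, rfl⟩, hiX⟩
  have hi : i ≤ n := hi
  rcases Nat.eq_zero_or_pos i with rfl | hi0
  · exact Or.inl rfl
  · rcases hi.lt_or_eq with hi | rfl
    · exact absurd hiX (h.inner_notMem i hi0 hi)
    · exact Or.inr rfl

/-- Oddness excludes the one degenerate closed walk, of length 2, that goes along an edge and back
along the same edge. -/
lemma IsEarWalk.isRoundEar (h : IsEarWalk G X n x e) (hn : Odd n) :
    IsRoundEar (Graft.walkGraph G n x e h.isLink) X := by
  have hn0 := hn.pos
  have hinj := h.injOn_Ico_zero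
  refine ⟨⟨e 0, 0, hn0, rfl⟩, ?_⟩
  by_cases hx : x 0 = x n
  · refine Or.inr ⟨⟨n, x, e, hn0, hx.symm, fun i hi j hj => hinj ⟨Nat.zero_le i, hi⟩
      ⟨Nat.zero_le j, hj⟩, ?_, ?_, rfl, h.walkGraph.isLink⟩, x 0, ?_⟩
    · have key : ∀ i j, i < j → j < n → e i ≠ e j := by
        intro i j hij hj heq
        have hl := h.isLink i (hij.trans hj)
        rw [heq] at hl
        rcases hl.eq_and_eq_or_eq_and_eq (h.isLink j hj) with ⟨h1, -⟩ | ⟨h1, h2⟩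
        · exact hij.ne (hinj ⟨Nat.zero_le i, hij.trans hj⟩ ⟨Nat.zero_le j, hj⟩ h1)
        · have h3 := hinj ⟨Nat.zero_le (i + 1), by omega⟩ ⟨Nat.zero_le j, hj⟩ h2
          rcases Nat.lt_or_ge (j + 1) n with hj' | hj'
          · have := hinj ⟨Nat.zero_le i, hij.trans hj⟩ ⟨Nat.zero_le (j + 1), hj'⟩ h1
            omega
          · have hjn : j + 1 = n := by omega
            rw [hjn, ← hx] at h1
            have := hinj ⟨Nat.zero_le i, hij.trans hj⟩ ⟨le_refl 0, hn0⟩ h1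
            grind
      intro i hi j hj hij
      rcases lt_trichotomy i j with hlt | rfl | hlt
      · exact absurd hij (key i j hlt hj)
      · rfl
      · exact absurd hij.symm (key j i hlt hi)
    · change x '' Set.Iic n = _
      refine Set.Subset.antisymm ?_ (Set.image_mono Set.Iio_subset_Iic_self)
      rintro _ ⟨i, hi, rfl⟩
      have hi : i ≤ n := hi
      rcases hi.lt_or_eq with hi | rfl
      · exact ⟨i, hi, rfl⟩
      · exact ⟨0, hn0, hx⟩
    · change x '' Set.Iic n ∩ X = _
      rw [h.inter_eq, ← hx, Set.pair_eq_singleton]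
  · refine Or.inl ⟨x 0, x n, ⟨n, x, e, rfl, rfl, ?_, rfl, rfl, h.walkGraph.isLink⟩, h.inter_eq⟩
    have key : ∀ i < n, x i ≠ x n := by
      intro i hi heq
      rcases Nat.eq_zero_or_pos i with rfl | hi0
      · exact hx heq
      · exact h.inner_notMem i hi0 hi (heq ▸ h.last_mem)
    intro i hi j hj hij
    have hi : i ≤ n := hi
    have hj : j ≤ n := hj
    rcases hi.lt_or_eq with hi | rfl <;> rcases hj.lt_or_eq with hj | rfl
    · exact hinj ⟨Nat.zero_le i, hi⟩ ⟨Nat.zero_le j, hj⟩ hij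
    · exact absurd hij (key i hi)
    · exact absurd hij.symm (key j hj)
    · rfl

/-- Alternate edges match the inner vertices, and this matching is the required join. -/
lemma IsEarWalk.isGraft_walkGraph (h : IsEarWalk G X (2 * k + 1) x e) :
    IsGraft (Graft.walkGraph G (2 * k + 1) x e h.isLink)
      (V(Graft.walkGraph G (2 * k + 1) x e h.isLink) \ X) := by
  have hIco : Set.Ico 1 (1 + 2 * k) = Set.Ioo 0 (2 * k + 1) := by ext i; grind
  obtain ⟨K, hKE, -, -, hodd⟩ := exists_oddSet_eq_image
    (G := Graft.walkGraph G (2 * k + 1) x e h.isLink) (x := x) (e := e) 1 k (hIco ▸ h.injOn)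
    fun j hj => h.walkGraph.isLink _ (by omega)
  refine isGraft_of_isJoin (F := K) ((Set.finite_Iic _).image x) ((Set.finite_Iio _).image e)
    Set.sdiff_subset ((isJoin_iff Set.sdiff_subset).2 ⟨hKE, ?_⟩)
  rw [hodd, hIco, h.walkGraph.vertexSet_sdiff rfl]

lemma EarFamily.extend (hH : EarFamily r H (V(H) \ {r})) (hle : H ≤ G) (hr : r ∈ V(H))
    (hw : IsEarWalk G V(H) (2 * k + 1) x e) :
    ∃ H' ≤ G, EarFamily r H' (V(H') \ {r}) ∧ V(H') = V(H) ∪ x '' Set.Iic (2 * k + 1) ∧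
      E(H') = E(H) ∪ e '' Set.Iio (2 * k + 1) := by
  have hPG : walkGraph G (2 * k + 1) x e hw.isLink ≤ G := walkGraph_le (by omega) hw.isLink
  have hc : H.Compatible (walkGraph G (2 * k + 1) x e hw.isLink) := .of_le_le hle hPG
  refine ⟨graphSum H _ hc, ⟨Set.union_subset hle.vertexSet_mono hPG.vertexSet_mono, ?_⟩, ?_,
    rfl, rfl⟩
  · rintro f a b (hl | hl)
    · exact hl.mono hle
    · exact hl.mono hPG
  · have := EarFamily.addEar H _ _ _ hH hw.isGraft_walkGraph hc (hw.isRoundEar ⟨k, rfl⟩)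
      (by rw [Set.sdiff_self_inter]) (by
        rw [Set.inter_assoc, Set.inter_sdiff_self, Set.inter_empty])
    rwa [sdiff_singleton_symmDiff_sdiff hr] at this

/-- The vertices visited from `w` by applying `m` and `p` alternately. -/
def alternating (m p : α → α) (w : α) : ℕ → α
  | 0 => w
  | j + 1 => if Even j then m (alternating m p w j) else p (alternating m p w j)

lemma alternating_succ_of_even {j : ℕ} (hj : Even j) :
    alternating m p w (j + 1) = m (alternating m p w j) := by
  simp [alternating, hj]

lemma alternating_succ_of_odd {j : ℕ} (hj : Odd j) :
    alternating m p w (j + 1) = p (alternating m p w j) := by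
  simp [alternating, Nat.not_even_iff_odd.2 hj]

lemma alternating_mem (hm : IsNearMatching G r m) (hp : IsNearMatching G w p) (hw : w ∈ V(G))
    (j : ℕ) : alternating m p w j ∈ V(G) := by
  induction j with
  | zero => exact hw
  | succ j ih =>
    rcases Nat.even_or_odd j with hj | hj
    · rw [alternating_succ_of_even hj]
      exact hm.map_mem _ ih
    · rw [alternating_succ_of_odd hj]
      exact hp.map_mem _ ih

lemma alternating_of_even (hm : IsNearMatching G r m) (hp : IsNearMatching G w p) (hw : w ∈ V(G))
    {j : ℕ} (hj : Even j) :
    m (alternating m p w (j + 1)) = alternating m p w j := by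
  rw [alternating_succ_of_even hj, hm.map_map _ (alternating_mem hm hp hw j)]

lemma alternating_of_odd (hm : IsNearMatching G r m) (hp : IsNearMatching G w p) (hw : w ∈ V(G))
    {j : ℕ} (hj : Odd j) :
    p (alternating m p w (j + 1)) = alternating m p w j := by
  rw [alternating_succ_of_odd hj, hp.map_map _ (alternating_mem hm hp hw j)]

/-- A repetition `i < j` is pulled back by the matching used in the last step, which sends index `j`
to `j - 1` and, away from fixed points, index `i` to a neighbouring index: an earlier repetition.
The exceptions are fixed points of `m` or `p`, that is `r`, excluded by `hr`, and `w`, which would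
again give an earlier repetition with index 0. -/
lemma alternating_ne (hm : IsNearMatching G r m) (hp : IsNearMatching G w p) (hw : w ∈ V(G))
    {j : ℕ} (hr : ∀ l < j, alternating m p w l ≠ r) {i : ℕ} (hij : i < j) :
    alternating m p w i ≠ alternating m p w j := by
  induction j using Nat.strong_induction_on generalizing i with
  | _ j ih =>
  have ih' : ∀ l < j, ∀ i < l, alternating m p w i ≠ alternating m p w l :=
    fun l hl i hi => ih l hl (fun q hq => hr q (hq.trans hl)) hi
  have hmem := alternating_mem hm hp hw
  intro heq
  obtain ⟨l, rfl⟩ : ∃ l, j = l + 1 := ⟨j - 1, by omega⟩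
  rcases Nat.even_or_odd l with hl | hl
  · have h1 := alternating_of_even hm hp hw hl
    rw [← heq] at h1
    rcases Nat.even_or_odd i with hi | hi
    · rw [← alternating_succ_of_even (m := m) (p := p) (w := w) hi] at h1
      rcases eq_or_ne i l with rfl | hil
      · rw [alternating_succ_of_even hi] at h1
        exact hm.map_ne _ (hmem i) (hr i hij) h1
      · exact ih' l (by omega) (i + 1) (by grind) h1
    · obtain ⟨q, rfl⟩ : ∃ q, i = q + 1 := ⟨i - 1, by grind⟩
      rw [alternating_of_even hm hp hw (by grind)] at h1
      exact ih' l (by omega) q (by omega) h1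
  · have h1 := alternating_of_odd hm hp hw hl
    rw [← heq] at h1
    rcases Nat.eq_zero_or_pos i with rfl | hi0
    · have h2 : p (alternating m p w 0) = alternating m p w 0 := hp.map_root
      rw [h2] at h1
      exact ih' l (by omega) 0 (by grind) h1
    rcases Nat.even_or_odd i with hi | hi
    · obtain ⟨q, rfl⟩ : ∃ q, i = q + 1 := ⟨i - 1, by omega⟩
      rw [alternating_of_odd hm hp hw (by grind)] at h1
      exact ih' l (by omega) q (by omega) h1
    · rcases eq_or_ne i l with rfl | hil
      · exact hp.map_ne _ (hmem i) (fun h => ih' i hij 0 hi0 h.symm) h1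
      · rw [← alternating_succ_of_odd (m := m) (p := p) (w := w) hi] at h1
        exact ih' l (by omega) (i + 1) (by grind) h1

lemma exists_alternating_mem (hm : IsNearMatching G r m) (hp : IsNearMatching G w p)
    (hw : w ∈ V(G)) (hV : V(G).Finite) (hr : r ∈ X) : ∃ j, alternating m p w j ∈ X := by
  by_contra! hcon
  have hne : ∀ l, alternating m p w l ≠ r := fun l h => hcon l (h ▸ hr)
  refine Set.infinite_of_injective_forall_mem (f := alternating m p w) (fun i j hij => ?_)
    (alternating_mem hm hp hw) hV
  rcases lt_trichotomy i j with h | h | h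
  · exact absurd hij (alternating_ne hm hp hw (fun l _ => hne l) h)
  · exact h
  · exact absurd hij.symm (alternating_ne hm hp hw (fun l _ => hne l) h)

/-- An ear starting with a given edge at `X` and continuing along an alternating path. -/
lemma exists_isEarWalk (hm : IsNearMatching G r m) (hp : IsNearMatching G w p)
    (hV : V(G).Finite) (hr : r ∈ X) (hX : ∀ v ∈ X, m v ∈ X) {f : β} {u : α}
    (hf : G.IsLink f u w) (hu : u ∈ X) :
    ∃ k x e, IsEarWalk G X (2 * k + 1) x e ∧ e 0 = f ∧
      ∀ v ∈ x '' Set.Iic (2 * k + 1), v ∉ X → m v ∈ x '' Set.Iic (2 * k + 1) := by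
  classical
  have hwV := hf.right_mem
  have hex := exists_alternating_mem hm hp hwV hV hr
  set z := alternating m p w with hz
  obtain ⟨q, hqX, hmin⟩ : ∃ q, z q ∈ X ∧ ∀ l < q, z l ∉ X :=
    ⟨Nat.find hex, Nat.find_spec hex, fun l hl => Nat.find_min hex hl⟩
  have hne : ∀ l < q, z l ≠ r := fun l hl h => hmin l hl (h ▸ hr)
  have hmem : ∀ j, z j ∈ V(G) := alternating_mem hm hp hwV
  have hdist : ∀ i j, i < j → j ≤ q → z i ≠ z j := fun i j hij hj =>
    alternating_ne hm hp hwV (fun l hl => hne l (hl.trans_le hj)) hij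
  -- If `X` were first entered by an `m`-step, closure of `X` under `m` would put the preceding
  -- vertex in `X` too.
  have hq : Even q := by
    by_contra hq
    obtain ⟨l, rfl⟩ : ∃ l, q = l + 1 := ⟨q - 1, by grind⟩
    have := hX _ hqX
    rw [hz, alternating_of_even hm hp hwV (by grind)] at this
    exact hmin l (by omega) this
  obtain ⟨k, rfl⟩ : ∃ k, q = 2 * k := ⟨q / 2, by grind⟩
  have hadj : ∀ j < 2 * k, G.Adj (z j) (z (j + 1)) := by
    intro j hj
    rcases Nat.even_or_odd j with hje | hjo
    · rw [hz, alternating_succ_of_even hje]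
      exact hm.adj _ (hmem j) (hne j hj)
    · rw [hz, alternating_succ_of_odd hjo]
      exact hp.adj _ (hmem j) fun h => hdist 0 j (by grind) hj.le h.symm
  have hedge : ∀ j, ∃ g, j < 2 * k → G.IsLink g (z j) (z (j + 1)) := fun j => by
    by_cases hj : j < 2 * k
    · obtain ⟨g, hg⟩ := hadj j hj
      exact ⟨g, fun _ => hg⟩
    · exact ⟨f, fun h => absurd h hj⟩
  choose d hd using hedge
  -- Prepending `u` shifts indices by one, so the even number of alternating steps gives an ear of
  -- odd length.
  set x : ℕ → α := fun i => i.casesOn u z with hx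
  have hx1 : ∀ j, x (j + 1) = z j := fun j => rfl
  refine ⟨k, x, fun i => i.casesOn f d, ⟨hu, hqX, ?_, ?_, ?_⟩, rfl, ?_⟩
  · intro i hi0 hi
    obtain ⟨j, rfl⟩ : ∃ j, i = j + 1 := ⟨i - 1, by omega⟩
    exact hmin j (by omega)
  · intro i hi j hj hij
    obtain ⟨a, rfl⟩ : ∃ a, i = a + 1 := ⟨i - 1, by grind⟩
    obtain ⟨b, rfl⟩ : ∃ b, j = b + 1 := ⟨j - 1, by grind⟩
    rw [hx1, hx1] at hij
    rcases lt_trichotomy a b with h | h | h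
    · exact absurd hij (hdist a b h (by grind))
    · rw [h]
    · exact absurd hij.symm (hdist b a h (by grind))
  · intro i hi
    rcases i with _ | j
    · exact hf
    · exact hd j (by omega)
  · rintro _ ⟨i, hi, rfl⟩ hiX
    have hi : i ≤ 2 * k + 1 := hi
    rcases i with _ | j
    · exact absurd hu hiX
    rw [hx1] at hiX ⊢
    have hjq : j ≠ 2 * k := fun h => hiX (h ▸ hqX)
    -- The `m`-partner of an inner vertex is its successor for even `j` and its predecessor for odd
    -- `j`.
    rcases Nat.even_or_odd j with hje | hjo
    · refine ⟨j + 2, by grind, ?_⟩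
      rw [hx1, hz, alternating_succ_of_even hje]
    · obtain ⟨l, rfl⟩ : ∃ l, j = l + 1 := ⟨j - 1, by grind⟩
      refine ⟨l + 1, by grind, ?_⟩
      rw [hx1, hz, alternating_of_even hm hp hwV (by grind)]

lemma exists_adj_of_reflTransGen {a b : α} (h : Relation.ReflTransGen G.Adj a b) (ha : a ∈ X)
    (hb : b ∉ X) : ∃ u ∈ X, ∃ w ∉ X, G.Adj u w := by
  induction h with
  | refl => exact absurd ha hb
  | @tail c d _ hcd ih =>
    by_cases hc : c ∈ X
    · exact ⟨c, hc, d, hb, hcd⟩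
    · exact ih hc

lemma EarFamily.of_le (hV : V(G).Finite) (hE : E(G).Finite) (hm : IsNearMatching G r m)
    (hp : ∀ w ∈ V(G), ∃ p, IsNearMatching G w p)
    (hconn : ∀ v ∈ V(G), Relation.ReflTransGen G.Adj r v) (hH : EarFamily r H (V(H) \ {r}))
    (hle : H ≤ G) (hr : r ∈ V(H)) (hclosed : ∀ v ∈ V(H), m v ∈ V(H)) :
    EarFamily r G (V(G) \ {r}) := by
  induction hn : (E(G) \ E(H)).ncard using Nat.strong_induction_on generalizing H with
  | _ n ih =>
  -- Any odd ear whose first edge is new and whose inner vertices have their `m`-partners on the ear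
  -- reduces the number of missing edges and keeps the subgraph closed under `m`.
  have step : ∀ k x e, IsEarWalk G V(H) (2 * k + 1) x e → e 0 ∉ E(H) →
      (∀ v ∈ x '' Set.Iic (2 * k + 1), v ∉ V(H) → m v ∈ x '' Set.Iic (2 * k + 1)) →
      EarFamily r G (V(G) \ {r}) := by
    intro k x e hw he0 hmx
    obtain ⟨H', hle', hH', hV', hE'⟩ := hH.extend hle hr hw
    refine ih _ ?_ hH' hle' (hV' ▸ Or.inl hr) ?_ rfl
    · rw [← hn]
      refine Set.ncard_lt_ncard ⟨Set.sdiff_subset_sdiff_right (hE' ▸ Set.subset_union_left),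
        fun hsub => ?_⟩ hE.sdiff
      exact (hsub ⟨(hw.isLink 0 (by omega)).edge_mem, he0⟩).2
        (hE' ▸ Or.inr ⟨0, Set.mem_Iio.2 (by omega), rfl⟩)
    · rw [hV']
      intro v hv
      by_cases hvH : v ∈ V(H)
      · exact Or.inl (hclosed v hvH)
      · exact Or.inr (hmx v (hv.resolve_left hvH) hvH)
  by_cases hVH : V(G) ⊆ V(H)
  · by_cases hEH : E(G) ⊆ E(H)
    · have : H = G := (Graph.Compatible.of_le hle).ext (hle.vertexSet_mono.antisymm hVH)
        (hle.edgeSet_mono.antisymm hEH)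
      rwa [this] at hH
    -- All vertices are present, so a missing edge is an ear of length 1, possibly a loop.
    · obtain ⟨f, hf, hfH⟩ := Set.not_subset.1 hEH
      obtain ⟨a, b, hab⟩ := G.exists_isLink_of_mem_edgeSet hf
      refine step 0 (fun i => if i = 0 then a else b) (fun _ => f) ⟨?_, ?_, ?_, ?_, ?_⟩ hfH ?_
      · simpa using hVH hab.left_mem
      · simpa using hVH hab.right_mem
      · intro i h0 h1
        omega
      · intro i hi
        grind
      · intro i hi
        obtain rfl : i = 0 := by omega
        simpa using hab
      · rintro _ ⟨i, hi, rfl⟩ hiH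
        refine absurd ?_ hiH
        dsimp only
        split_ifs
        exacts [hVH hab.left_mem, hVH hab.right_mem]
  -- By connectedness some edge leaves `H`; its outer end `w` is the root for the second matching.
  · obtain ⟨v, hv, hvH⟩ := Set.not_subset.1 hVH
    obtain ⟨u, hu, w, hw, f, hf⟩ := exists_adj_of_reflTransGen (hconn v hv) hr hvH
    obtain ⟨p, hp⟩ := hp w hf.right_mem
    obtain ⟨k, x, e, hwalk, he0, hmx⟩ := exists_isEarWalk hm hp hV hr hclosed hf hu
    refine step k x e hwalk (fun he => ?_) hmx
    rw [he0] at he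
    exact hw ((hle.isLink_iff he).2 hf).right_mem

lemma IsFactorCritical.earFamily (h : IsFactorCritical G T r) : EarFamily r G T := by
  obtain ⟨m, hm⟩ := h.exists_isNearMatching
  have hp : ∀ w ∈ V(G), ∃ p, IsNearMatching G w p := by
    intro w hw
    by_cases hwr : w = r
    · exact ⟨m, hwr ▸ hm⟩
    · exact (h.change_root hw hwr).exists_isNearMatching
  have hbase : EarFamily r (Graph.noEdge {r} β) (V(Graph.noEdge {r} β) \ {r}) := by
    have : V(Graph.noEdge {r} β) \ {r} = ∅ := by simp
    rw [this]
    exact EarFamily.single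
  rw [h.eq_sdiff]
  refine EarFamily.of_le h.isGraft.finite_vertexSet h.isGraft.finite_edgeSet hm hp
    (fun v hv => h.reflTransGen_adj hv) hbase (by simpa using h.root_mem) (by simp) ?_
  intro v hv
  have hv : v = r := by simpa using hv
  subst hv
  simp [hm.map_root]

end EarConstruction

end Graft

theorem theorem6p3 {α β : Type*} (G : Graph α β) (T : Set α) (r : α) :
    Graft.IsFactorCritical G T r ↔ Graft.EarFamily r G T := by
  refine ⟨fun h => h.earFamily, fun h => ?_⟩
  obtain ⟨rfl, hG⟩ := h.eq_sdiff_and_hasNearPerfectJoins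
  exact hG.isFactorCritical
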